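/- Let $\alpha\in(0,1)$ and let $\phi:[0,1]\to\mathbb R$ be continuous on $[0,1]$ and twice continuously differentiable on $(0,1)$. Suppose that the second divergence speed of $\phi$ is $p^\alpha$, i.e. there are constants $W>0$, $c_0\ge 0$, $c_0'\ge 0$ such that $$W p^{\alpha-2}-c_0'\;\le\;|\phi''(p)|\;\le\; W p^{\alpha-2}+c_0\qquad\text{for all }p\in(0,1).$$ For an integer $L\ge 0$ and $\lambda\in(0,1)$ let $$E_L(\phi,[0,\lambda])=\inf_{g}\ \sup_{x\in[0,\lambda]}|\phi(x)-g(x)|,$$ where $g$ ranges over the real polynomials of degree at most $L$. Then $$\liminf_{L\to\infty,\ \lambda\downarrow 0}\Bigl(\frac{L^2}{\lambda}\Bigr)^{\alpha}E_L(\phi,[0,\lambda])>0,$$ where $L\to\infty$ and $\lambda\downarrow0$ jointly and independently. Moreover $E_L(\phi,[0,\lambda])\asymp(\lambda/L^2)^\alpha$: there are constants $c,C>0$, depending only on $\phi$ and $\alpha$, such that for all integers $L\ge1$ and all $\lambda\in(0,1)$, $$c\Bigl(\frac{\lambda}{L^2}\Bigr)^{\alpha}\le E_L(\phi,[0,\lambda])\le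 C\Bigl(\frac{\lambda}{L^2}\Bigr)^{\alpha}.$$ -/

import Mathlib

open Set Filter Topology Polynomial

/-- The `ℓ`th divergence speed of `φ : [0,1] → ℝ` is `p ^ α` (`ℓ` a positive integer).
A function on `[0,1]` is represented by a function on `ℝ` whose values outside `[0,1]` are never
used. The regularity is continuity on `[0,1]` together with `ℓ`-fold continuous differentiability
on the open interval: for `α < ℓ` the `ℓ`th derivative is unbounded near `0`, so
differentiability cannot be required at the end point `0`. -/
def HasDivergenceSpeed (ℓ : ℕ) (α : ℝ) (φ : ℝ → ℝ) : Prop :=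
  ContinuousOn φ (Icc 0 1) ∧
  ContDiffOn ℝ (ℓ : WithTop ℕ∞) φ (Ioo 0 1) ∧
  ∃ W c c' : ℝ, 0 < W ∧ 0 ≤ c ∧ 0 ≤ c' ∧
    ∀ p ∈ Ioo (0 : ℝ) 1,
      W * p ^ (-(ℓ : ℝ) + α) - c' ≤ |iteratedDeriv ℓ φ p| ∧
      |iteratedDeriv ℓ φ p| ≤ W * p ^ (-(ℓ : ℝ) + α) + c

/-- The best polynomial approximation error
`E_L(φ, I) = inf_{deg g ≤ L} sup_{x ∈ I} |φ x - g x|`, for `φ` bounded on the bounded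
nonempty set `I` (in particular for `φ` continuous on a compact interval `I`). -/
noncomputable def bestPolyError (L : ℕ) (φ : ℝ → ℝ) (I : Set ℝ) : ℝ :=
  ⨅ g : {g : ℝ[X] // g.natDegree ≤ L}, ⨆ x : I, |φ x - (g : ℝ[X]).eval (x : ℝ)|

/-- The trigonometric polynomial `|∑ aᵢ e^{i t}|²`, in real form. -/
noncomputable def squareKernel (n : ℕ) (a : ℕ → ℝ) (t : ℝ) : ℝ :=
  ∑ i ∈ Finset.range n, ∑ j ∈ Finset.range n, a i * a j * Real.cos (((i : ℝ) - j) * t)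

lemma squareKernel_eq (n : ℕ) (a : ℕ → ℝ) (t : ℝ) :
    squareKernel n a t = (∑ i ∈ Finset.range n, a i * Real.cos (i * t)) ^ 2 +
      (∑ i ∈ Finset.range n, a i * Real.sin (i * t)) ^ 2 := by
  rw [squareKernel, sq, sq, Finset.sum_mul_sum, Finset.sum_mul_sum, ← Finset.sum_add_distrib]
  refine Finset.sum_congr rfl fun i _ => ?_
  rw [← Finset.sum_add_distrib]
  refine Finset.sum_congr rfl fun j _ => ?_
  rw [sub_mul, Real.cos_sub]
  ring

lemma squareKernel_nonneg (n : ℕ) (a : ℕ → ℝ) (t : ℝ) : 0 ≤ squareKernel n a t := by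
  rw [squareKernel_eq]
  positivity

@[fun_prop]
lemma continuous_squareKernel (n : ℕ) (a : ℕ → ℝ) : Continuous (squareKernel n a) := by
  unfold squareKernel
  fun_prop

lemma integral_cos_int_mul (m : ℤ) :
    ∫ t in (-Real.pi)..Real.pi, Real.cos (m * t) = if m = 0 then 2 * Real.pi else 0 := by
  split_ifs with h
  · simp [h]; ring
  · have hm : (m : ℝ) ≠ 0 := by exact_mod_cast h
    rw [intervalIntegral.integral_comp_mul_left _ hm]
    simp [Real.sin_int_mul_pi]

lemma integral_squareKernel (n : ℕ) (a : ℕ → ℝ) :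
    ∫ t in (-Real.pi)..Real.pi, squareKernel n a t
      = 2 * Real.pi * ∑ i ∈ Finset.range n, a i ^ 2 := by
  unfold squareKernel
  rw [intervalIntegral.integral_finsetSum
    (fun i _ => (by fun_prop : Continuous _).intervalIntegrable _ _), Finset.mul_sum]
  refine Finset.sum_congr rfl fun i hi => ?_
  rw [intervalIntegral.integral_finsetSum
    (fun i _ => (by fun_prop : Continuous _).intervalIntegrable _ _)]
  rw [Finset.sum_eq_single_of_mem i hi]
  · simp; ring
  · intro j _ hj
    have := integral_cos_int_mul ((i : ℤ) - j)
    rw [if_neg (by omega)] at this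
    push_cast at this
    rw [intervalIntegral.integral_const_mul, this, mul_zero]

lemma integral_cos_mul_one_sub_cos (m : ℤ) :
    ∫ t in (-Real.pi)..Real.pi, Real.cos (m * t) * (1 - Real.cos t)
      = 2 * Real.pi * ((if m = 0 then 1 else 0) - (if m = -1 then 1 else 0) / 2
        - (if m = 1 then 1 else 0) / 2) := by
  have h : ∀ t : ℝ, Real.cos (m * t) * (1 - Real.cos t) =
      Real.cos (m * t) - Real.cos ((m + 1 : ℤ) * t) / 2 - Real.cos ((m - 1 : ℤ) * t) / 2 := by
    intro t
    push_cast
    rw [add_mul, sub_mul, Real.cos_add, Real.cos_sub]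
    ring_nf
  simp_rw [h]
  rw [intervalIntegral.integral_sub, intervalIntegral.integral_sub,
    intervalIntegral.integral_div, intervalIntegral.integral_div, integral_cos_int_mul,
    integral_cos_int_mul, integral_cos_int_mul]
  · simp only [eq_neg_iff_add_eq_zero, sub_eq_zero]
    split_ifs <;> ring
  all_goals exact (by fun_prop : Continuous _).intervalIntegrable _ _

/-- The Fejér–Korovkin identity. -/
lemma integral_squareKernel_mul_one_sub_cos (L : ℕ) :
    ∫ t in (-Real.pi)..Real.pi,
        squareKernel (L + 1) (fun i => Real.sin ((i + 1) * (Real.pi / (L + 2)))) t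
          * (1 - Real.cos t)
      = 2 * Real.pi * (1 - Real.cos (Real.pi / (L + 2))) *
        ∑ i ∈ Finset.range (L + 1), Real.sin ((i + 1) * (Real.pi / (L + 2))) ^ 2 := by
  set w : ℝ := Real.pi / (L + 2) with hw
  have hL : (L + 2 : ℝ) ≠ 0 := by positivity
  have hend : Real.sin ((L + 2) * w) = 0 := by
    rw [hw, mul_div_cancel₀ _ hL, Real.sin_pi]
  unfold squareKernel
  simp_rw [Finset.sum_mul]
  rw [intervalIntegral.integral_finsetSum
    (fun i _ => (by fun_prop : Continuous _).intervalIntegrable _ _), Finset.mul_sum]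
  refine Finset.sum_congr rfl fun i hi => ?_
  rw [intervalIntegral.integral_finsetSum
    (fun i _ => (by fun_prop : Continuous _).intervalIntegrable _ _)]
  have hterm : ∀ j : ℕ, ∫ t in (-Real.pi)..Real.pi,
      Real.sin ((i + 1) * w) * Real.sin ((j + 1) * w) * Real.cos (((i : ℝ) - j) * t)
        * (1 - Real.cos t) = 2 * Real.pi * Real.sin ((i + 1) * w) *
        ((if j = i then Real.sin ((j + 1) * w) else 0)
          - (if j = i + 1 then Real.sin ((j + 1) * w) else 0) / 2
          - (if j + 1 = i then Real.sin ((j + 1) * w) else 0) / 2) := by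
    intro j
    have h := integral_cos_mul_one_sub_cos ((i : ℤ) - j)
    push_cast at h
    simp_rw [mul_assoc]
    rw [intervalIntegral.integral_const_mul, intervalIntegral.integral_const_mul, h]
    have e1 : ((i : ℤ) - j = 0) ↔ j = i := by omega
    have e2 : ((i : ℤ) - j = -1) ↔ j = i + 1 := by omega
    have e3 : ((i : ℤ) - j = 1) ↔ j + 1 = i := by omega
    simp only [e1, e2, e3]
    split_ifs <;> ring
  simp_rw [hterm]
  rw [← Finset.mul_sum, Finset.sum_sub_distrib, Finset.sum_sub_distrib, ← Finset.sum_div,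
    ← Finset.sum_div, Finset.sum_ite_eq' (Finset.range (L + 1)) i, if_pos hi,
    Finset.sum_ite_eq' (Finset.range (L + 1)) (i + 1)]
  have h1 : (if i + 1 ∈ Finset.range (L + 1) then Real.sin ((((i + 1 : ℕ) : ℝ) + 1) * w) else 0)
      = Real.sin ((i + 1) * w + w) := by
    split_ifs with h
    · push_cast; ring_nf
    · have : i = L := by simp at h hi; omega
      rw [this, ← hend]; ring_nf
  have h2 : ∑ j ∈ Finset.range (L + 1), (if j + 1 = i then Real.sin (((j : ℝ) + 1) * w) else 0)
      = Real.sin ((i + 1) * w - w) := by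
    rcases i with _ | i
    · simp
    · simp only [add_left_inj]
      rw [Finset.sum_ite_eq', if_pos (by simp at hi ⊢; omega)]
      push_cast; ring_nf
  rw [h1, h2, Real.sin_add, Real.sin_sub]
  ring

/-- Convolving an even `2π`-periodic function with `cos (m t)` gives a multiple of `cos (m t)`. -/
lemma integral_comp_add_mul_cos {G : ℝ → ℝ} (hG : Continuous G) (heven : ∀ t, G (-t) = G t)
    (hper : Function.Periodic G (2 * Real.pi)) (m : ℤ) (θ : ℝ) :
    ∫ t in (-Real.pi)..Real.pi, G (θ + t) * Real.cos (m * t)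
      = Real.cos (m * θ) * ∫ t in (-Real.pi)..Real.pi, G t * Real.cos (m * t) := by
  have hodd : ∫ t in (-Real.pi)..Real.pi, G t * Real.sin (m * t) = 0 := by
    have h := intervalIntegral.integral_comp_neg (a := -Real.pi) (b := Real.pi)
      (fun t => G t * Real.sin (m * t))
    simp only [heven, neg_neg, mul_neg, Real.sin_neg, intervalIntegral.integral_neg] at h
    linarith
  set f : ℝ → ℝ := fun s => G s * Real.cos (m * (s - θ)) with hf
  have hfper : Function.Periodic f (2 * Real.pi) := by
    intro s
    simp only [hf]
    rw [hper s, show (m : ℝ) * (s + 2 * Real.pi - θ) = m * (s - θ) + m * (2 * Real.pi) by ring,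
      Real.cos_add_int_mul_two_pi]
  have h1 : ∫ t in (-Real.pi)..Real.pi, G (θ + t) * Real.cos (m * t)
      = ∫ s in (θ + -Real.pi)..(θ + Real.pi), f s := by
    rw [← intervalIntegral.integral_comp_add_left]
    simp [hf]
  have h2 := hfper.intervalIntegral_add_eq (θ + -Real.pi) (-Real.pi)
  rw [show θ + -Real.pi + 2 * Real.pi = θ + Real.pi by ring,
    show -Real.pi + 2 * Real.pi = Real.pi by ring] at h2
  rw [h1, h2]
  have h3 : ∀ s, f s = Real.cos (m * θ) * (G s * Real.cos (m * s))
      + Real.sin (m * θ) * (G s * Real.sin (m * s)) := by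
    intro s
    simp only [hf]
    rw [mul_sub, Real.cos_sub]
    ring
  simp_rw [h3]
  rw [intervalIntegral.integral_add, intervalIntegral.integral_const_mul,
    intervalIntegral.integral_const_mul, hodd, mul_zero, add_zero]
  all_goals exact (by fun_prop : Continuous _).intervalIntegrable _ _

lemma integral_comp_add_mul_squareKernel {G : ℝ → ℝ} (hG : Continuous G)
    (heven : ∀ t, G (-t) = G t) (hper : Function.Periodic G (2 * Real.pi)) (n : ℕ) (a : ℕ → ℝ)
    (θ : ℝ) :
    ∫ t in (-Real.pi)..Real.pi, G (θ + t) * squareKernel n a t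
      = ∑ i ∈ Finset.range n, ∑ j ∈ Finset.range n, a i * a j *
        (Real.cos (((i : ℝ) - j) * θ) *
          ∫ t in (-Real.pi)..Real.pi, G t * Real.cos (((i : ℝ) - j) * t)) := by
  unfold squareKernel
  simp_rw [Finset.mul_sum]
  rw [intervalIntegral.integral_finsetSum
    (fun i _ => (by fun_prop : Continuous _).intervalIntegrable _ _)]
  refine Finset.sum_congr rfl fun i hi => ?_
  rw [intervalIntegral.integral_finsetSum
    (fun i _ => (by fun_prop : Continuous _).intervalIntegrable _ _)]
  refine Finset.sum_congr rfl fun j hj => ?_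
  have h := integral_comp_add_mul_cos hG heven hper ((i : ℤ) - j) θ
  push_cast at h
  rw [← h, ← intervalIntegral.integral_const_mul]
  congr 1
  ext t
  ring

/-- Jackson's theorem for functions with second differences of order `t²`. -/
lemma exists_polynomial_abs_sub_le_of_second_difference {g : ℝ → ℝ} {M : ℝ}
    (hg : ContinuousOn g (Icc 0 1))
    (hM : ∀ θ t : ℝ, |g ((1 - Real.cos (θ + t)) / 2) + g ((1 - Real.cos (θ - t)) / 2)
      - 2 * g ((1 - Real.cos θ) / 2)| ≤ M * t ^ 2) (L : ℕ) :
    ∃ P : ℝ[X], P.natDegree ≤ L ∧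
      ∀ x ∈ Icc (0 : ℝ) 1, |g x - P.eval x| ≤ M * Real.pi ^ 4 / 8 / (L + 2) ^ 2 := by
  set G : ℝ → ℝ := fun t => g ((1 - Real.cos t) / 2) with hGdef
  have hmem : ∀ t : ℝ, (1 - Real.cos t) / 2 ∈ Icc (0 : ℝ) 1 := fun t =>
    ⟨by linarith [Real.cos_le_one t], by linarith [Real.neg_one_le_cos t]⟩
  have hG : Continuous G := hg.comp_continuous (by fun_prop) hmem
  have heven : ∀ t, G (-t) = G t := fun t => by simp [hGdef]
  have hper : Function.Periodic G (2 * Real.pi) := fun t => by simp [hGdef]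
  have hM0 : 0 ≤ M := by simpa using (abs_nonneg _).trans (hM 0 1)
  set a : ℕ → ℝ := fun i => Real.sin ((i + 1) * (Real.pi / (L + 2))) with ha
  set A : ℝ := ∑ i ∈ Finset.range (L + 1), a i ^ 2 with hA
  have hApos : 0 < A := by
    refine Finset.sum_pos (fun i hi => ?_) ⟨0, by simp⟩
    have hi' : (i : ℝ) + 1 < L + 2 := by
      have : i < L + 1 := Finset.mem_range.1 hi
      have : (i : ℝ) < L + 1 := by exact_mod_cast this
      linarith
    have : 0 < a i := by
      refine Real.sin_pos_of_pos_of_lt_pi (by positivity) ?_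
      rw [← mul_div_assoc, div_lt_iff₀ (by positivity)]
      nlinarith [Real.pi_pos]
    positivity
  set K := squareKernel (L + 1) a with hK
  have hKc : Continuous K := continuous_squareKernel _ _
  set c : ℕ → ℕ → ℝ := fun i j =>
    ∫ t in (-Real.pi)..Real.pi, G t * Real.cos (((i : ℝ) - j) * t)
  refine ⟨C (1 / (2 * Real.pi * A)) * ∑ i ∈ Finset.range (L + 1), ∑ j ∈ Finset.range (L + 1),
    C (a i * a j * c i j) * (Chebyshev.T ℝ ((i : ℤ) - j)).comp (C 1 - C 2 * X), ?_, ?_⟩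
  · refine (natDegree_C_mul_le _ _).trans ?_
    refine natDegree_sum_le_of_forall_le _ _ fun i hi => ?_
    refine natDegree_sum_le_of_forall_le _ _ fun j hj => ?_
    refine (natDegree_C_mul_le _ _).trans ?_
    refine natDegree_comp_le.trans ?_
    have h1 : (C 1 - C 2 * X : ℝ[X]).natDegree ≤ 1 := by
      compute_degree
    have h2 : (Chebyshev.T ℝ ((i : ℤ) - j)).natDegree ≤ L := by
      rw [Chebyshev.natDegree_T]
      simp at hi hj
      omega
    calc _ ≤ L * 1 := Nat.mul_le_mul h2 h1
      _ = L := mul_one L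
  · intro x hx
    obtain ⟨θ, rfl⟩ : ∃ θ, (1 - Real.cos θ) / 2 = x :=
      ⟨Real.arccos (1 - 2 * x), by
        rw [Real.cos_arccos (by linarith [hx.2]) (by linarith [hx.1])]; ring⟩
    have hconv := integral_comp_add_mul_squareKernel hG heven hper (L + 1) a θ
    set Q := ∫ t in (-Real.pi)..Real.pi, G (θ + t) * K t with hQ
    have hP : eval ((1 - Real.cos θ) / 2) (C (1 / (2 * Real.pi * A)) *
        ∑ i ∈ Finset.range (L + 1), ∑ j ∈ Finset.range (L + 1),
        C (a i * a j * c i j) * (Chebyshev.T ℝ ((i : ℤ) - j)).comp (C 1 - C 2 * X))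
        = 1 / (2 * Real.pi * A) * Q := by
      rw [hconv, eval_mul, eval_C, eval_finsetSum]
      congr 1
      refine Finset.sum_congr rfl fun i _ => ?_
      rw [eval_finsetSum]
      refine Finset.sum_congr rfl fun j _ => ?_
      have := Chebyshev.T_real_cos θ ((i : ℤ) - j)
      push_cast at this
      rw [eval_mul, eval_C, eval_comp, ← this]
      simp only [eval_sub, eval_mul, eval_C, eval_X]
      rw [show 1 - 2 * ((1 - Real.cos θ) / 2) = Real.cos θ by ring]
      ring
    rw [hP]
    have hneg : ∫ t in (-Real.pi)..Real.pi, G (θ - t) * K t = Q := by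
      have h := intervalIntegral.integral_comp_neg (a := -Real.pi) (b := Real.pi)
        (fun t => G (θ + t) * K t)
      rw [neg_neg] at h
      rw [hQ, ← h]
      congr 1
      ext t
      simp [hK, squareKernel, sub_eq_add_neg]
    have hIK : ∫ t in (-Real.pi)..Real.pi, K t = 2 * Real.pi * A := integral_squareKernel _ _
    have hdiff : ∫ t in (-Real.pi)..Real.pi, (G (θ + t) + G (θ - t) - 2 * G θ) * K t
        = 2 * Q - 2 * G θ * (2 * Real.pi * A) := by
      have : ∀ t, (G (θ + t) + G (θ - t) - 2 * G θ) * K t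
          = G (θ + t) * K t + G (θ - t) * K t - 2 * G θ * K t := fun t => by ring
      simp_rw [this]
      rw [intervalIntegral.integral_sub, intervalIntegral.integral_add, hneg,
        intervalIntegral.integral_const_mul, hIK]
      · ring
      all_goals exact (by fun_prop : Continuous _).intervalIntegrable _ _
    have hcos : 1 - Real.cos (Real.pi / (L + 2)) ≤ (Real.pi / (L + 2)) ^ 2 / 2 := by
      linarith [Real.one_sub_sq_div_two_le_cos (x := Real.pi / (L + 2))]
    have hbound : |∫ t in (-Real.pi)..Real.pi, (G (θ + t) + G (θ - t) - 2 * G θ) * K t|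
        ≤ M * (Real.pi ^ 2 / 2) * (2 * Real.pi * (1 - Real.cos (Real.pi / (L + 2))) * A) := by
      rw [hA, ha, ← integral_squareKernel_mul_one_sub_cos, ← intervalIntegral.integral_const_mul,
        ← Real.norm_eq_abs]
      refine intervalIntegral.norm_integral_le_of_norm_le (by linarith [Real.pi_pos])
        (Eventually.of_forall fun t ht => ?_)
        ((by fun_prop : Continuous _).intervalIntegrable _ _)
      have hc := Real.cos_le_one_sub_mul_cos_sq (x := t) (abs_le.2 ⟨ht.1.le, ht.2⟩)
      have hK0 : 0 ≤ K t := squareKernel_nonneg _ _ _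
      rw [Real.norm_eq_abs, abs_mul, abs_of_nonneg hK0, mul_comm (squareKernel _ _ t), ← mul_assoc]
      refine mul_le_mul_of_nonneg_right ((hM θ t).trans ?_) hK0
      rw [mul_assoc]
      refine mul_le_mul_of_nonneg_left ?_ hM0
      have : t ^ 2 = Real.pi ^ 2 / 2 * (2 / Real.pi ^ 2 * t ^ 2) := by
        field_simp
      rw [this]
      exact mul_le_mul_of_nonneg_left (by linarith) (by positivity)
    rw [hdiff] at hbound
    have hpA : 0 < 2 * Real.pi * A := by positivity
    have hkey : g ((1 - Real.cos θ) / 2) - 1 / (2 * Real.pi * A) * Q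
        = -(2 * Q - 2 * G θ * (2 * Real.pi * A)) / (2 * (2 * Real.pi * A)) := by
      simp only [hGdef]
      field_simp
      ring
    rw [hkey, abs_div, abs_neg, abs_of_pos (by positivity : 0 < 2 * (2 * Real.pi * A)),
      div_le_iff₀ (by positivity)]
    refine hbound.trans ?_
    calc M * (Real.pi ^ 2 / 2) * (2 * Real.pi * (1 - Real.cos (Real.pi / (L + 2))) * A)
        ≤ M * (Real.pi ^ 2 / 2) * (2 * Real.pi * ((Real.pi / (L + 2)) ^ 2 / 2) * A) := by
          gcongr
      _ = M * Real.pi ^ 4 / 8 / (L + 2) ^ 2 * (2 * (2 * Real.pi * A)) := by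
          field_simp
          ring

lemma abs_second_difference_le {G G₁ G₂ : ℝ → ℝ} {M : ℝ} (h₁ : ∀ x, HasDerivAt G (G₁ x) x)
    (h₂ : ∀ x, HasDerivAt G₁ (G₂ x) x) (hM : ∀ x, |G₂ x| ≤ M) (θ t : ℝ) :
    |G (θ + t) + G (θ - t) - 2 * G θ| ≤ 2 * M * t ^ 2 := by
  have hlip : ∀ x y, |G₁ y - G₁ x| ≤ M * |y - x| := fun x y =>
    convex_univ.norm_image_sub_le_of_norm_hasDerivWithin_le
      (fun z _ => (h₂ z).hasDerivWithinAt) (fun z _ => hM z) (mem_univ x) (mem_univ y)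
  have hM0 : 0 ≤ M := (abs_nonneg _).trans (hM 0)
  have hd : ∀ s : ℝ, HasDerivAt (fun s => G (θ + s) + G (θ - s)) (G₁ (θ + s) - G₁ (θ - s)) s := by
    intro s
    have e1 := (h₁ (θ + s)).comp_const_add θ s
    have e2 := (h₁ (θ - s)).comp_const_sub θ s
    simpa [sub_eq_add_neg, Function.comp_def] using e1.fun_add e2
  have := (convex_uIcc 0 t).norm_image_sub_le_of_norm_hasDerivWithin_le
    (C := 2 * M * |t|) (fun z _ => (hd z).hasDerivWithinAt) (fun z hz => ?_)
    left_mem_uIcc right_mem_uIcc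
  · simp only [Real.norm_eq_abs, add_zero, sub_zero] at this
    rw [mul_assoc, abs_mul_abs_self, ← sq] at this
    rwa [two_mul (G θ)]
  · have hz' : |z| ≤ |t| := by
      simpa using abs_sub_left_of_mem_uIcc hz
    rw [Real.norm_eq_abs]
    refine (hlip _ _).trans ?_
    rw [show θ + z - (θ - z) = 2 * z by ring, abs_mul, abs_two]
    nlinarith

/-- Jackson's theorem on `[0,1]`, with the weight `x` on the second derivative. -/
lemma exists_polynomial_abs_sub_le {g g₁ g₂ : ℝ → ℝ} {B : ℝ} (hg : ContinuousOn g (Icc 0 1))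
    (h₁ : ∀ x ∈ Ioo (0 : ℝ) 1, HasDerivAt g (g₁ x) x)
    (h₂ : ∀ x ∈ Ioo (0 : ℝ) 1, HasDerivAt g₁ (g₂ x) x)
    (hB₁ : ∀ x ∈ Ioo (0 : ℝ) 1, |g₁ x| ≤ B) (hB₂ : ∀ x ∈ Ioo (0 : ℝ) 1, x * |g₂ x| ≤ B) (L : ℕ) :
    ∃ P : ℝ[X], P.natDegree ≤ L ∧
      ∀ x ∈ Icc (0 : ℝ) 1, |g x - P.eval x| ≤ B * Real.pi ^ 4 / (L + 2) ^ 2 := by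
  have hB0 : 0 ≤ B := (abs_nonneg _).trans (hB₁ (1 / 2) (by norm_num))
  have key := exists_polynomial_abs_sub_le_of_second_difference (M := 4 * B) hg ?_ L
  · obtain ⟨P, hP, h⟩ := key
    refine ⟨P, hP, fun x hx => (h x hx).trans ?_⟩
    gcongr
    nlinarith [pow_pos Real.pi_pos 4]
  intro θ t
  set Y : ℝ → ℝ → ℝ := fun ε s => ε / 2 + (1 - ε) * ((1 - Real.cos s) / 2) with hY
  have hmem : ∀ s : ℝ, 0 ≤ (1 - Real.cos s) / 2 ∧ (1 - Real.cos s) / 2 ≤ 1 := fun t =>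
    ⟨by linarith [Real.cos_le_one t], by linarith [Real.neg_one_le_cos t]⟩
  have hYmem : ∀ ε ∈ Ioo (0 : ℝ) 1, ∀ s, Y ε s ∈ Ioo (0 : ℝ) 1 := by
    intro ε hε s
    obtain ⟨h0, h1⟩ := hmem s
    obtain ⟨e0, e1⟩ := hε
    simp only [hY]
    constructor <;> nlinarith
  have hlim : ∀ s, Tendsto (fun ε => g (Y ε s)) (𝓝[>] 0) (𝓝 (g ((1 - Real.cos s) / 2))) := by
    intro s
    refine (hg _ (hmem s)).tendsto.comp (tendsto_nhdsWithin_iff.2 ⟨?_, ?_⟩)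
    · have : Continuous fun ε => Y ε s := by simp only [hY]; fun_prop
      have h := (this.tendsto 0).mono_left (nhdsWithin_le_nhds (s := Ioi (0 : ℝ)))
      simpa [hY] using h
    · filter_upwards [Ioo_mem_nhdsGT (zero_lt_one' ℝ)] with ε hε
      exact Ioo_subset_Icc_self (hYmem ε hε s)
  refine le_of_tendsto (((hlim _).add (hlim _)).sub ((hlim θ).const_mul 2)).abs ?_
  filter_upwards [Ioo_mem_nhdsGT (zero_lt_one' ℝ)] with ε hε
  have hYd : ∀ s, HasDerivAt (Y ε) ((1 - ε) * (Real.sin s / 2)) s := by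
    intro s
    have := ((((Real.hasDerivAt_cos s).const_sub 1).div_const 2).const_mul (1 - ε)).const_add (ε / 2)
    simpa [hY] using this
  have hYd2 : ∀ s, HasDerivAt (fun s => (1 - ε) * (Real.sin s / 2))
      ((1 - ε) * (Real.cos s / 2)) s := fun s =>
    ((Real.hasDerivAt_sin s).div_const 2).const_mul (1 - ε)
  have main := abs_second_difference_le (M := 2 * B)
    (fun s => (h₁ _ (hYmem ε hε s)).comp s (hYd s))
    (fun s => ((h₂ _ (hYmem ε hε s)).comp s (hYd s)).mul (hYd2 s)) ?_ θ t
  · simp only [Function.comp] at main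
    linarith
  · intro s
    obtain ⟨e0, e1⟩ := hε
    have hy := hYmem ε ⟨e0, e1⟩ s
    have b1 := hB₁ _ hy
    have b2 := hB₂ _ hy
    have hsq : ((1 - ε) * (Real.sin s / 2)) ^ 2 ≤ Y ε s := by
      obtain ⟨h0, h1⟩ := hmem s
      have : (Real.sin s / 2) ^ 2 = (1 - Real.cos s) / 2 * (1 - (1 - Real.cos s) / 2) := by
        have := Real.sin_sq_add_cos_sq s
        nlinarith
      rw [mul_pow, this]
      simp only [hY]
      set x := (1 - Real.cos s) / 2
      have : (1 - ε) ^ 2 * (x * (1 - x)) ≤ (1 - ε) * x := by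
        have a1 : x * (1 - x) ≤ x := by nlinarith
        have a2 : (1 - ε) ^ 2 ≤ 1 - ε := by nlinarith
        have a3 : 0 ≤ x * (1 - x) := mul_nonneg h0 (by linarith)
        exact mul_le_mul a2 a1 a3 (by linarith)
      linarith
    have hc : |(1 - ε) * (Real.cos s / 2)| ≤ 1 := by
      rw [abs_mul, abs_div, abs_two, abs_of_pos (by linarith : 0 < 1 - ε)]
      nlinarith [Real.abs_cos_le_one s, abs_nonneg (Real.cos s)]
    refine (abs_add_le _ _).trans ?_
    have t1 : |g₂ (Y ε s) * ((1 - ε) * (Real.sin s / 2)) * ((1 - ε) * (Real.sin s / 2))| ≤ B := by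
      rw [mul_assoc, ← sq, abs_mul, abs_sq, mul_comm]
      exact (mul_le_mul_of_nonneg_right hsq (abs_nonneg _)).trans b2
    have t2 : |(g₁ ∘ Y ε) s * ((1 - ε) * (Real.cos s / 2))| ≤ B := by
      rw [abs_mul]
      calc _ ≤ B * 1 := mul_le_mul b1 hc (abs_nonneg _) hB0
        _ = B := mul_one B
    linarith

/-- The cosine coefficients of `sin ^ (2β)` on `[0, π]`. -/
noncomputable def sinMoment (β : ℝ) (k : ℕ) : ℝ :=
  ∫ s in (0 : ℝ)..Real.pi, Real.sin s ^ (2 * β) * Real.cos (2 * k * s)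

lemma continuous_sin_rpow {β : ℝ} (hβ : 0 ≤ β) : Continuous fun s => Real.sin s ^ (2 * β) :=
  Real.continuous_sin.rpow_const fun _ => Or.inr (by positivity)

lemma sinMoment_succ {β : ℝ} (hβ : 0 ≤ β) (k : ℕ) :
    (k + 1 + β) * sinMoment β (k + 1) = (k - β) * sinMoment β k := by
  have hc := continuous_sin_rpow hβ
  have hc' : Continuous fun s => Real.sin s ^ (2 * β + 1) :=
    Real.continuous_sin.rpow_const fun _ => Or.inr (by positivity)
  have hd : ∀ s : ℝ, HasDerivAt (fun s => Real.sin s ^ (2 * β + 1) * Real.cos ((2 * k + 1) * s))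
      ((2 * β + 1) * Real.sin s ^ (2 * β) * Real.cos s * Real.cos ((2 * k + 1) * s)
        - (2 * k + 1) * Real.sin s ^ (2 * β + 1) * Real.sin ((2 * k + 1) * s)) s := by
    intro s
    have e1 := (Real.hasDerivAt_sin s).rpow_const (p := 2 * β + 1) (Or.inr (by linarith))
    have e2 := (((hasDerivAt_id s).const_mul (2 * k + 1 : ℝ))).cos
    refine (e1.mul e2).congr_deriv ?_
    simp only [id, add_sub_cancel_right, mul_one]
    ring
  have hint := intervalIntegral.integral_eq_sub_of_hasDerivAt (a := 0) (b := Real.pi)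
    (fun s _ => hd s) ((by fun_prop : Continuous _).intervalIntegrable _ _)
  simp only [Real.sin_pi, Real.sin_zero, Real.zero_rpow (by linarith : 2 * β + 1 ≠ 0), zero_mul,
    sub_zero] at hint
  have hcongr : ∫ s in (0 : ℝ)..Real.pi,
      ((2 * β + 1) * Real.sin s ^ (2 * β) * Real.cos s * Real.cos ((2 * k + 1) * s)
        - (2 * k + 1) * Real.sin s ^ (2 * β + 1) * Real.sin ((2 * k + 1) * s))
      = ∫ s in (0 : ℝ)..Real.pi,
        ((k + 1 + β) * (Real.sin s ^ (2 * β) * Real.cos (2 * (k + 1 : ℕ) * s))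
          - (k - β) * (Real.sin s ^ (2 * β) * Real.cos (2 * k * s))) := by
    refine intervalIntegral.integral_congr fun s hs => ?_
    rw [uIcc_of_le Real.pi_pos.le] at hs
    have hs0 := Real.sin_nonneg_of_mem_Icc hs
    rw [Real.rpow_add_one' hs0 (by linarith)]
    push_cast
    have a1 : Real.cos (2 * (k + 1) * s) = Real.cos ((2 * k + 1) * s) * Real.cos s
        - Real.sin ((2 * k + 1) * s) * Real.sin s := by
      rw [← Real.cos_add]; ring_nf
    have a2 : Real.cos (2 * k * s) = Real.cos ((2 * k + 1) * s) * Real.cos s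
        + Real.sin ((2 * k + 1) * s) * Real.sin s := by
      rw [← Real.cos_sub]; ring_nf
    rw [a1, a2]
    ring
  rw [hcongr, intervalIntegral.integral_sub, intervalIntegral.integral_const_mul,
    intervalIntegral.integral_const_mul] at hint
  · unfold sinMoment
    linarith
  all_goals exact (by fun_prop : Continuous _).intervalIntegrable _ _

lemma sinMoment_natCast_eq_zero {n k : ℕ} (h : n < k) : sinMoment n k = 0 := by
  induction k, h using Nat.le_induction with
  | base =>
    have := sinMoment_succ (Nat.cast_nonneg n : (0 : ℝ) ≤ n) n
    rw [sub_self, zero_mul] at this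
    exact (mul_eq_zero.1 this).resolve_left (by positivity)
  | succ k hk ih =>
    have := sinMoment_succ (Nat.cast_nonneg n : (0 : ℝ) ≤ n) k
    rw [ih, mul_zero] at this
    exact (mul_eq_zero.1 this).resolve_left (by positivity)

lemma integral_polynomial_sin_sq_mul_cos {P : ℝ[X]} {k : ℕ} (h : P.natDegree < k) :
    ∫ s in (0 : ℝ)..Real.pi, P.eval (Real.sin s ^ 2) * Real.cos (2 * k * s) = 0 := by
  simp_rw [eval_eq_sum_range, Finset.sum_mul]
  rw [intervalIntegral.integral_finsetSum
    (fun i _ => (by fun_prop : Continuous _).intervalIntegrable _ _)]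
  refine Finset.sum_eq_zero fun i hi => ?_
  have hik : i < k := by
    have := Finset.mem_range.1 hi
    omega
  have h0 := sinMoment_natCast_eq_zero hik
  unfold sinMoment at h0
  simp_rw [mul_assoc (P.coeff i)]
  rw [intervalIntegral.integral_const_mul]
  have : ∀ s, (Real.sin s ^ 2) ^ i = Real.sin s ^ (2 * (i : ℝ)) := fun s => by
    rw [← pow_mul, ← Real.rpow_natCast]
    push_cast
    rfl
  simp_rw [this, h0, mul_zero]

lemma sinMoment_one_neg {α : ℝ} (hα : α ∈ Ioo (0 : ℝ) 1) : sinMoment α 1 < 0 := by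
  have h0 : 0 < sinMoment α 0 := by
    unfold sinMoment
    simp only [Nat.cast_zero, mul_zero, zero_mul, Real.cos_zero, mul_one]
    exact intervalIntegral.intervalIntegral_pos_of_pos_on
      ((continuous_sin_rpow hα.1.le).intervalIntegrable _ _)
      (fun s hs => Real.rpow_pos_of_pos (Real.sin_pos_of_mem_Ioo hs) _) Real.pi_pos
  have h := sinMoment_succ hα.1.le 0
  simp only [Nat.cast_zero, zero_add, zero_sub] at h
  have : 0 < α * sinMoment α 0 := mul_pos hα.1 h0
  by_contra! hcon
  nlinarith [mul_nonneg (by linarith [hα.1] : (0 : ℝ) ≤ 1 + α) hcon]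

lemma exists_le_neg_sinMoment {α : ℝ} (hα : α ∈ Ioo (0 : ℝ) 1) :
    ∃ c : ℝ, 0 < c ∧ ∀ k : ℕ, 1 ≤ k → c ≤ (k : ℝ) ^ (1 + 2 * α) * (-sinMoment α k) := by
  obtain ⟨ha0, ha1⟩ := hα
  have hI := sinMoment_one_neg ⟨ha0, ha1⟩
  have hpos : 0 < (1 - α) ^ (1 + 2 * α) * (-sinMoment α 1) :=
    mul_pos (Real.rpow_pos_of_pos (by linarith) _) (by linarith)
  refine ⟨_, hpos, fun k hk => ?_⟩
  have main : 0 < -sinMoment α k ∧ (1 - α) ^ (1 + 2 * α) * (-sinMoment α 1)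
      ≤ ((k : ℝ) - α) ^ (1 + 2 * α) * (-sinMoment α k) := by
    induction k, hk using Nat.le_induction with
    | base => exact ⟨by linarith, by simp⟩
    | succ k hk ih =>
      obtain ⟨ih0, ih⟩ := ih
      have hk1 : (1 : ℝ) ≤ k := by exact_mod_cast hk
      have hka : 0 < (k : ℝ) - α := by linarith
      have hrec := sinMoment_succ ha0.le k
      have hform : -sinMoment α (k + 1) = (k - α) / (k + 1 + α) * (-sinMoment α k) := by
        field_simp
        linarith
      refine ⟨by rw [hform]; positivity, ih.trans ?_⟩
      rw [hform, ← mul_assoc]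
      refine mul_le_mul_of_nonneg_right ?_ ih0.le
      have hb := one_add_mul_self_le_rpow_one_add (s := 1 / ((k : ℝ) - α))
        (by linarith [div_pos one_pos hka]) (p := 1 + 2 * α) (by linarith)
      have e1 : 1 + (1 + 2 * α) * (1 / ((k : ℝ) - α)) = (k + 1 + α) / (k - α) := by
        field_simp
        ring
      have e2 : 1 + 1 / ((k : ℝ) - α) = (k + 1 - α) / (k - α) := by
        field_simp
        ring
      rw [e1, e2, Real.div_rpow (by linarith) hka.le, div_le_div_iff₀ hka (by positivity)] at hb
      push_cast
      rw [mul_div_assoc', le_div_iff₀ (by positivity)]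
      linarith
  refine main.2.trans (mul_le_mul_of_nonneg_right ?_ main.1.le)
  have hk1 : (1 : ℝ) ≤ k := by exact_mod_cast hk
  exact Real.rpow_le_rpow (by linarith) (by linarith) (by linarith)

/-- A modulated Fejér kernel, with frequencies between `L + 1` and `3 L + 1`. -/
noncomputable def modulatedFejer (L : ℕ) (s : ℝ) : ℝ :=
  ∑ i ∈ Finset.range (L + 1), ∑ j ∈ Finset.range (L + 1),
    Real.cos (2 * (2 * L + 1 + i - j : ℕ) * s)

lemma abs_modulatedFejer_le (L : ℕ) (s : ℝ) :
    |modulatedFejer L s| ≤ squareKernel (L + 1) (fun _ => 1) (2 * s) := by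
  have hanti : ∑ i ∈ Finset.range (L + 1), ∑ j ∈ Finset.range (L + 1),
      Real.sin (((i : ℝ) - j) * (2 * s)) = 0 := by
    have h : ∑ i ∈ Finset.range (L + 1), ∑ j ∈ Finset.range (L + 1),
        Real.sin (((i : ℝ) - j) * (2 * s)) = -∑ i ∈ Finset.range (L + 1),
          ∑ j ∈ Finset.range (L + 1), Real.sin (((i : ℝ) - j) * (2 * s)) := by
      conv_lhs => rw [Finset.sum_comm]
      simp_rw [← Finset.sum_neg_distrib]
      refine Finset.sum_congr rfl fun i _ => Finset.sum_congr rfl fun j _ => ?_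
      rw [← Real.sin_neg]
      ring_nf
    linarith
  have heq : modulatedFejer L s = Real.cos ((2 * L + 1) * (2 * s)) *
      squareKernel (L + 1) (fun _ => 1) (2 * s) := by
    have : modulatedFejer L s = Real.cos ((2 * L + 1) * (2 * s)) *
        squareKernel (L + 1) (fun _ => 1) (2 * s) - Real.sin ((2 * L + 1) * (2 * s)) *
          ∑ i ∈ Finset.range (L + 1), ∑ j ∈ Finset.range (L + 1),
            Real.sin (((i : ℝ) - j) * (2 * s)) := by
      unfold modulatedFejer squareKernel
      simp_rw [Finset.mul_sum, ← Finset.sum_sub_distrib]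
      refine Finset.sum_congr rfl fun i _ => Finset.sum_congr rfl fun j hj => ?_
      have hj' : j ≤ 2 * L + 1 + i := by
        have := Finset.mem_range.1 hj
        omega
      rw [one_mul, one_mul, ← Real.cos_add, Nat.cast_sub hj']
      push_cast
      ring_nf
    rw [this, hanti, mul_zero, sub_zero]
  rw [heq, abs_mul, abs_of_nonneg (squareKernel_nonneg _ _ _)]
  exact mul_le_of_le_one_left (squareKernel_nonneg _ _ _) (Real.abs_cos_le_one _)

lemma integral_squareKernel_comp_two_mul (n : ℕ) (a : ℕ → ℝ) :
    ∫ s in (0 : ℝ)..Real.pi, squareKernel n a (2 * s)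
      = Real.pi * ∑ i ∈ Finset.range n, a i ^ 2 := by
  have hper : Function.Periodic (squareKernel n a) (2 * Real.pi) := by
    intro t
    unfold squareKernel
    refine Finset.sum_congr rfl fun i _ => Finset.sum_congr rfl fun j _ => ?_
    have := Real.cos_add_int_mul_two_pi (((i : ℝ) - j) * t) ((i : ℤ) - j)
    push_cast at this
    rw [mul_add, this]
  have h := hper.intervalIntegral_add_eq 0 (-Real.pi)
  rw [show -Real.pi + 2 * Real.pi = Real.pi by ring, integral_squareKernel, zero_add] at h
  rw [intervalIntegral.integral_comp_mul_left _ two_ne_zero, mul_zero, h, smul_eq_mul]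
  ring

/-- Bernstein's lower bound for the approximation of `x ^ α` on `[0,1]`. -/
lemma exists_le_approximation_error_rpow {α : ℝ} (hα : α ∈ Ioo (0 : ℝ) 1) :
    ∃ c : ℝ, 0 < c ∧ ∀ L : ℕ, 1 ≤ L → ∀ P : ℝ[X], P.natDegree ≤ L → ∀ ε : ℝ,
      (∀ x ∈ Icc (0 : ℝ) 1, |x ^ α - P.eval x| ≤ ε) → c * (1 / (L : ℝ) ^ 2) ^ α ≤ ε := by
  obtain ⟨c, hc, hcoef⟩ := exists_le_neg_sinMoment hα
  have h4 : (0 : ℝ) < 4 ^ (1 + 2 * α) := by positivity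
  refine ⟨c / (4 ^ (1 + 2 * α) * Real.pi), by have := Real.pi_pos; positivity,
    fun L hL P hP ε hε => ?_⟩
  have hL1 : (1 : ℝ) ≤ L := by exact_mod_cast hL
  have hL0 : (0 : ℝ) < L := by linarith
  have hcF := continuous_sin_rpow hα.1.le
  have hterm : ∀ k : ℕ, L < k → ∫ s in (0 : ℝ)..Real.pi,
      (Real.sin s ^ (2 * α) - P.eval (Real.sin s ^ 2)) * Real.cos (2 * k * s) = sinMoment α k := by
    intro k hk
    simp_rw [sub_mul]
    rw [intervalIntegral.integral_sub, integral_polynomial_sin_sq_mul_cos (by omega), sub_zero,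
      sinMoment]
    all_goals exact (by fun_prop : Continuous _).intervalIntegrable _ _
  have hsum : ∫ s in (0 : ℝ)..Real.pi,
      (Real.sin s ^ (2 * α) - P.eval (Real.sin s ^ 2)) * modulatedFejer L s
      = ∑ i ∈ Finset.range (L + 1), ∑ j ∈ Finset.range (L + 1),
        sinMoment α (2 * L + 1 + i - j) := by
    unfold modulatedFejer
    simp_rw [Finset.mul_sum]
    rw [intervalIntegral.integral_finsetSum
      (fun i _ => (by fun_prop : Continuous _).intervalIntegrable _ _)]
    refine Finset.sum_congr rfl fun i hi => ?_
    rw [intervalIntegral.integral_finsetSum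
      (fun i _ => (by fun_prop : Continuous _).intervalIntegrable _ _)]
    refine Finset.sum_congr rfl fun j hj => hterm _ ?_
    have := Finset.mem_range.1 hj
    omega
  set b : ℝ := c / (4 * L) ^ (1 + 2 * α) with hb
  have hlow : ((L : ℝ) + 1) * (((L : ℝ) + 1) * b) ≤ -∑ i ∈ Finset.range (L + 1),
      ∑ j ∈ Finset.range (L + 1), sinMoment α (2 * L + 1 + i - j) := by
    have : ((L : ℝ) + 1) * (((L : ℝ) + 1) * b)
        = ∑ i ∈ Finset.range (L + 1), ∑ j ∈ Finset.range (L + 1), b := by simp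
    rw [this, ← Finset.sum_neg_distrib]
    refine Finset.sum_le_sum fun i hi => ?_
    rw [← Finset.sum_neg_distrib]
    refine Finset.sum_le_sum fun j hj => ?_
    have hi' := Finset.mem_range.1 hi
    have hj' := Finset.mem_range.1 hj
    set k := 2 * L + 1 + i - j with hk
    have hk1 : 1 ≤ k := by omega
    have hk4 : (k : ℝ) ≤ 4 * L := by
      have : k ≤ 4 * L := by omega
      exact_mod_cast this
    have hk0 : (0 : ℝ) < k := by exact_mod_cast hk1
    have hck := hcoef k hk1
    have hneg : 0 ≤ -sinMoment α k := by
      by_contra! hcon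
      have := mul_neg_of_pos_of_neg (Real.rpow_pos_of_pos hk0 (1 + 2 * α)) hcon
      linarith
    rw [hb, div_le_iff₀ (by positivity)]
    refine hck.trans ?_
    rw [mul_comm]
    refine mul_le_mul_of_nonneg_left ?_ hneg
    exact Real.rpow_le_rpow hk0.le hk4 (by linarith [hα.1])
  have hup : |∫ s in (0 : ℝ)..Real.pi,
      (Real.sin s ^ (2 * α) - P.eval (Real.sin s ^ 2)) * modulatedFejer L s|
      ≤ ε * (Real.pi * (L + 1)) := by
    have hK : ∫ s in (0 : ℝ)..Real.pi, ε * squareKernel (L + 1) (fun _ => 1) (2 * s)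
        = ε * (Real.pi * (L + 1)) := by
      rw [intervalIntegral.integral_const_mul, integral_squareKernel_comp_two_mul]
      simp
    rw [← hK, ← Real.norm_eq_abs]
    refine intervalIntegral.norm_integral_le_of_norm_le Real.pi_pos.le
      (Eventually.of_forall fun s hs => ?_) ((by fun_prop : Continuous _).intervalIntegrable _ _)
    have hs0 := Real.sin_nonneg_of_mem_Icc (Ioc_subset_Icc_self hs)
    rw [Real.norm_eq_abs, abs_mul]
    have hx := hε (Real.sin s ^ 2) ⟨by positivity, Real.sin_sq_le_one s⟩
    rw [← Real.rpow_natCast (Real.sin s) 2, ← Real.rpow_mul hs0, Real.rpow_natCast] at hx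
    exact mul_le_mul hx (abs_modulatedFejer_le L s) (abs_nonneg _) ((abs_nonneg _).trans hx)
  rw [hsum] at hup
  have h1 := (hlow.trans (neg_le_abs _)).trans hup
  have h2 : ((L : ℝ) + 1) * b ≤ ε * Real.pi := by
    have : ((L : ℝ) + 1) * (((L : ℝ) + 1) * b) ≤ ((L : ℝ) + 1) * (ε * Real.pi) := by linarith
    exact le_of_mul_le_mul_left this (by positivity)
  have hb0 : 0 ≤ b := by positivity
  have h3 : (L : ℝ) * b ≤ ε * Real.pi := by nlinarith
  have h4 : c / (4 ^ (1 + 2 * α) * Real.pi) * (1 / (L : ℝ) ^ 2) ^ α = L * b / Real.pi := by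
    rw [hb, Real.mul_rpow (by norm_num) hL0.le, Real.rpow_add hL0 1, Real.rpow_one,
      Real.div_rpow zero_le_one (by positivity), Real.one_rpow, Real.rpow_mul hL0.le]
    norm_num
    have : (0 : ℝ) < ((L : ℝ) ^ 2) ^ α := by positivity
    have := Real.pi_pos
    field_simp
  rw [h4, div_le_iff₀ Real.pi_pos]
  exact h3

lemma exists_polynomial_rpow_approximation {α : ℝ} (hα : α ∈ Ioo (0 : ℝ) 1) {L : ℕ} (hL : 1 ≤ L) :
    ∃ P : ℝ[X], P.natDegree ≤ L ∧ ∀ x ∈ Icc (0 : ℝ) 1,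
      |x ^ α - P.eval x| ≤ (Real.pi ^ 4 + 1) * (1 / (L : ℝ) ^ 2) ^ α := by
  obtain ⟨ha0, ha1⟩ := hα
  have hL0 : (0 : ℝ) < L := by exact_mod_cast hL
  set h : ℝ := 1 / (L : ℝ) ^ 2 with hh
  have h0 : 0 < h := by positivity
  have hanti : ∀ x ∈ Ioo (0 : ℝ) 1, (x + h) ^ (α - 1) ≤ h ^ (α - 1) := fun x hx =>
    Real.rpow_le_rpow_of_nonpos h0 (by linarith [hx.1]) (by linarith)
  obtain ⟨P, hP, hPe⟩ := exists_polynomial_abs_sub_le (g := fun x => (x + h) ^ α)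
    (g₁ := fun x => α * (x + h) ^ (α - 1)) (g₂ := fun x => α * ((α - 1) * (x + h) ^ (α - 1 - 1)))
    (B := h ^ (α - 1))
    (fun x _ => ((continuous_id.add continuous_const).rpow_const
      fun _ => Or.inr ha0.le).continuousWithinAt)
    (fun x hx => by
      simpa using ((hasDerivAt_id x).add_const h).rpow_const (p := α)
        (Or.inl (by simp only [id]; linarith [hx.1])))
    (fun x hx => by
      have := ((hasDerivAt_id x).add_const h).rpow_const (p := α - 1)
        (Or.inl (by simp only [id]; linarith [hx.1]))
      simpa using this.const_mul α)
    (fun x hx => by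
      have hxh : 0 < x + h := by linarith [hx.1]
      rw [abs_of_pos (by positivity)]
      exact (mul_le_of_le_one_left (by positivity) ha1.le).trans (hanti x hx))
    (fun x hx => by
      have hxh : 0 < x + h := by linarith [hx.1]
      have hr : 0 ≤ (x + h) ^ (α - 1 - 1) := by positivity
      rw [abs_mul, abs_mul, abs_of_pos ha0, abs_of_neg (by linarith : α - 1 < 0), abs_of_nonneg hr]
      have e : (x + h) ^ (α - 1) = (x + h) * (x + h) ^ (α - 1 - 1) := by
        rw [Real.rpow_sub_one hxh.ne' (α - 1)]
        field_simp
      refine le_trans ?_ (hanti x hx)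
      rw [e]
      have h1 : α * -(α - 1) ≤ 1 := by nlinarith
      have h2 : α * (-(α - 1) * (x + h) ^ (α - 1 - 1)) ≤ (x + h) ^ (α - 1 - 1) := by
        rw [← mul_assoc]
        exact mul_le_of_le_one_left hr h1
      calc _ ≤ x * (x + h) ^ (α - 1 - 1) := mul_le_mul_of_nonneg_left h2 hx.1.le
        _ ≤ _ := mul_le_mul_of_nonneg_right (by linarith) hr) L
  refine ⟨P, hP, fun x hx => ?_⟩
  have b1 : |x ^ α - (x + h) ^ α| ≤ h ^ α := by
    have u := Real.rpow_add_le_add_rpow hx.1 h0.le ha0.le ha1.le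
    have v := Real.rpow_le_rpow hx.1 (by linarith : x ≤ x + h) ha0.le
    rw [abs_le]
    constructor <;> linarith
  have b2 : h ^ (α - 1) * Real.pi ^ 4 / (L + 2) ^ 2 ≤ Real.pi ^ 4 * h ^ α := by
    have e : h ^ α = h ^ (α - 1) * h := by
      rw [Real.rpow_sub_one h0.ne']
      field_simp
    rw [e, div_eq_mul_inv, mul_comm (h ^ (α - 1)), mul_assoc]
    have : (((L : ℝ) + 2) ^ 2)⁻¹ ≤ h := by
      rw [hh, ← one_div]
      gcongr
      linarith
    gcongr
  have := abs_sub_le (x ^ α) ((x + h) ^ α) (P.eval x)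
  linarith [hPe x hx]

lemma natDegree_comp_C_mul_X_le (P : ℝ[X]) (r : ℝ) :
    (P.comp (C r * X)).natDegree ≤ P.natDegree :=
  natDegree_comp_le.trans ((Nat.mul_le_mul le_rfl ((natDegree_C_mul_le r X).trans natDegree_X_le)).trans (mul_one _).le)

lemma exists_polynomial_approximation_of_bounded_second_deriv {ψ ψ₁ ψ₂ : ℝ → ℝ} {B : ℝ}
    (hψ : ContinuousOn ψ (Icc 0 1)) (h₁ : ∀ x ∈ Ioo (0 : ℝ) 1, HasDerivAt ψ (ψ₁ x) x)
    (h₂ : ∀ x ∈ Ioo (0 : ℝ) 1, HasDerivAt ψ₁ (ψ₂ x) x) (hB : ∀ x ∈ Ioo (0 : ℝ) 1, |ψ₂ x| ≤ B)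
    {L : ℕ} (hL : 1 ≤ L) {l : ℝ} (hl : l ∈ Ioo (0 : ℝ) 1) :
    ∃ P : ℝ[X], P.natDegree ≤ L ∧ ∀ x ∈ Icc (0 : ℝ) l,
      |ψ x - P.eval x| ≤ B * Real.pi ^ 4 * l ^ 2 / (L : ℝ) ^ 2 := by
  obtain ⟨l0, l1⟩ := hl
  have hL0 : (0 : ℝ) < L := by exact_mod_cast hL
  have hB0 : 0 ≤ B := (abs_nonneg _).trans (hB l ⟨l0, l1⟩)
  have hmem : ∀ y ∈ Ioo (0 : ℝ) 1, l * y ∈ Ioo (0 : ℝ) 1 := fun y hy =>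
    ⟨mul_pos l0 hy.1, by nlinarith [hy.1, hy.2]⟩
  have hscale : ∀ y : ℝ, HasDerivAt (fun y => l * y) l y := fun y => by
    simpa using (hasDerivAt_id y).const_mul l
  have hhalf : l / 2 ∈ Ioo (0 : ℝ) 1 := ⟨by linarith, by linarith⟩
  obtain ⟨Q, hQ, hQe⟩ := exists_polynomial_abs_sub_le
    (g := fun y => ψ (l * y) - ψ₁ (l / 2) * (l * y))
    (g₁ := fun y => ψ₁ (l * y) * l - ψ₁ (l / 2) * l) (g₂ := fun y => ψ₂ (l * y) * l * l)
    (B := B * l ^ 2)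
    ((hψ.comp (by fun_prop) fun y hy => ⟨mul_nonneg l0.le hy.1, by nlinarith [hy.1, hy.2]⟩).sub
      (by fun_prop))
    (fun y hy => ((h₁ _ (hmem y hy)).comp y (hscale y)).sub ((hscale y).const_mul _))
    (fun y hy => (((h₂ _ (hmem y hy)).comp y (hscale y)).mul_const l).sub_const _)
    (fun y hy => by
      have := (convex_Ioo (0 : ℝ) 1).norm_image_sub_le_of_norm_hasDerivWithin_le
        (fun z hz => (h₂ z hz).hasDerivWithinAt) (fun z hz => hB z hz) hhalf (hmem y hy)
      rw [Real.norm_eq_abs, Real.norm_eq_abs] at this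
      have hd : |l * y - l / 2| ≤ l := by
        rw [abs_le]
        constructor <;> nlinarith [hy.1, hy.2]
      rw [← sub_mul, abs_mul, abs_of_pos l0, sq, ← mul_assoc]
      exact mul_le_mul_of_nonneg_right
        (this.trans (mul_le_mul_of_nonneg_left hd hB0)) l0.le)
    (fun y hy => by
      rw [abs_mul, abs_mul, abs_of_pos l0, mul_assoc, ← sq]
      have := hB _ (hmem y hy)
      refine (mul_le_of_le_one_left (by positivity) hy.2.le).trans ?_
      gcongr) L
  refine ⟨Q.comp (C (1 / l) * X) + C (ψ₁ (l / 2)) * X, ?_, fun x hx => ?_⟩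
  · exact (natDegree_add_le _ _).trans
      (max_le ((natDegree_comp_C_mul_X_le _ _).trans hQ) ((natDegree_C_mul_le _ X).trans (natDegree_X_le.trans hL)))
  · have hy : 1 / l * x ∈ Icc (0 : ℝ) 1 := by
      rw [one_div, inv_mul_eq_div]
      exact ⟨div_nonneg hx.1 l0.le, (div_le_one l0).2 hx.2⟩
    have hxy : l * (1 / l * x) = x := by field_simp
    have h := hQe _ hy
    simp only [hxy] at h
    simp only [eval_add, eval_comp, eval_mul, eval_C, eval_X]
    rw [show ψ x - (eval (1 / l * x) Q + ψ₁ (l / 2) * x)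
      = ψ x - ψ₁ (l / 2) * x - eval (1 / l * x) Q by ring]
    refine h.trans ?_
    rw [show B * l ^ 2 * Real.pi ^ 4 = B * Real.pi ^ 4 * l ^ 2 by ring]
    gcongr
    linarith

/-- A function with second divergence speed `p ^ α` is a multiple of `p ^ α` up to a function with
bounded second derivative. -/
lemma HasDivergenceSpeed.exists_decomposition {α : ℝ} (hα : α ∈ Ioo (0 : ℝ) 1) {φ : ℝ → ℝ}
    (hφ : HasDivergenceSpeed 2 α φ) :
    ∃ (D B : ℝ) (ψ ψ₁ ψ₂ : ℝ → ℝ), D ≠ 0 ∧ (∀ x, φ x = D * x ^ α + ψ x) ∧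
      ContinuousOn ψ (Icc 0 1) ∧ (∀ x ∈ Ioo (0 : ℝ) 1, HasDerivAt ψ (ψ₁ x) x) ∧
      (∀ x ∈ Ioo (0 : ℝ) 1, HasDerivAt ψ₁ (ψ₂ x) x) ∧ ∀ x ∈ Ioo (0 : ℝ) 1, |ψ₂ x| ≤ B := by
  obtain ⟨ha0, ha1⟩ := hα
  obtain ⟨hcont, hdiff, W, c, c', hW, hc, hc', hbd⟩ := hφ
  have hiter : iteratedDeriv 2 φ = deriv (deriv φ) := by
    rw [iteratedDeriv_succ, iteratedDeriv_one]
  set w : ℝ → ℝ := fun p => W * p ^ (α - 1 - 1) with hw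
  have hbd' : ∀ p ∈ Ioo (0 : ℝ) 1,
      w p - c' ≤ |deriv (deriv φ) p| ∧ |deriv (deriv φ) p| ≤ w p + c := by
    intro p hp
    have := hbd p hp
    rw [hiter, show -((2 : ℕ) : ℝ) + α = α - 1 - 1 by push_cast; ring] at this
    exact this
  have hdiff1 := (contDiffOn_succ_iff_deriv_of_isOpen (n := 1) isOpen_Ioo).1
    (by simpa [one_add_one_eq_two] using hdiff)
  have hdiff2 := (contDiffOn_succ_iff_deriv_of_isOpen (n := 0) isOpen_Ioo).1
    (by simpa using hdiff1.2.2)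
  have hd1 : ∀ x ∈ Ioo (0 : ℝ) 1, HasDerivAt φ (deriv φ x) x := fun x hx =>
    (hdiff1.1.differentiableAt (isOpen_Ioo.mem_nhds hx)).hasDerivAt
  have hd2 : ∀ x ∈ Ioo (0 : ℝ) 1, HasDerivAt (deriv φ) (deriv (deriv φ) x) x := fun x hx =>
    (hdiff2.1.differentiableAt (isOpen_Ioo.mem_nhds hx)).hasDerivAt
  have hcont2 : ContinuousOn (deriv (deriv φ)) (Ioo 0 1) := hdiff2.2.2.continuousOn
  set δ : ℝ := min (1 / 2) (W / (c' + 1)) with hδ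
  have hδ0 : 0 < δ := lt_min (by norm_num) (by positivity)
  have hδ1 : δ < 1 := (min_le_left _ _).trans_lt (by norm_num)
  have hsub : Ioo 0 δ ⊆ Ioo (0 : ℝ) 1 := Ioo_subset_Ioo_right hδ1.le
  have hne : ∀ p ∈ Ioo 0 δ, 0 < |deriv (deriv φ) p| := by
    intro p hp
    have hp1 := hsub hp
    have h1 : c' < w p := by
      have e : p⁻¹ ≤ p ^ (α - 1 - 1) := by
        rw [← Real.rpow_neg_one]
        exact Real.rpow_le_rpow_of_exponent_ge hp1.1 hp1.2.le (by linarith)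
      have hpW : p < W / (c' + 1) := hp.2.trans_le (min_le_right _ _)
      rw [lt_div_iff₀ (by positivity)] at hpW
      have h2 : c' + 1 < W * p⁻¹ := by
        rw [← div_eq_mul_inv, lt_div_iff₀ hp1.1]
        linarith
      have h3 : W * p⁻¹ ≤ w p := mul_le_mul_of_nonneg_left e hW.le
      linarith
    linarith [(hbd' p hp1).1]
  obtain ⟨σ, hσ, hσφ⟩ : ∃ σ : ℝ, |σ| = 1 ∧
      ∀ p ∈ Ioo 0 δ, deriv (deriv φ) p = σ * |deriv (deriv φ) p| := by
    rcases isPreconnected_Ioo.eq_or_eq_neg_of_sq_eq (hcont2.mono hsub) (hcont2.mono hsub).abs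
      (fun p _ => by simp) (fun hx => (hne _ hx).ne') with h | h
    · exact ⟨1, by simp, fun p hp => by rw [one_mul]; exact h hp⟩
    · exact ⟨-1, by simp, fun p hp => by rw [neg_one_mul]; exact h hp⟩
  have hD : W / (α * (α - 1)) ≠ 0 := by
    have : α - 1 ≠ 0 := by linarith
    positivity
  set D := σ * (W / (α * (α - 1))) with hDdef
  refine ⟨D, c + c' + 2 * (W * δ ^ (α - 1 - 1)), fun x => φ x - D * x ^ α,
    fun x => deriv φ x - D * (α * x ^ (α - 1)),
    fun x => deriv (deriv φ) x - D * (α * ((α - 1) * x ^ (α - 1 - 1))),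
    mul_ne_zero (by rintro rfl; simp at hσ) hD, fun x => by ring, ?_, ?_, ?_, ?_⟩
  · exact hcont.sub ((continuous_id.rpow_const fun _ => Or.inr ha0.le).const_mul D).continuousOn
  · exact fun x hx => (hd1 x hx).sub
      ((Real.hasDerivAt_rpow_const (Or.inl hx.1.ne')).const_mul D)
  · exact fun x hx => (hd2 x hx).sub
      (((Real.hasDerivAt_rpow_const (Or.inl hx.1.ne')).const_mul α).const_mul D)
  · intro x hx
    have e : D * (α * ((α - 1) * x ^ (α - 1 - 1))) = σ * w x := by
      have : α - 1 ≠ 0 := by linarith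
      simp only [hDdef, hw]
      field_simp
    simp only [e]
    have hwδ : 0 ≤ W * δ ^ (α - 1 - 1) := by positivity
    obtain ⟨b1, b2⟩ := hbd' x hx
    rcases lt_or_ge x δ with hxδ | hxδ
    · rw [hσφ x ⟨hx.1, hxδ⟩, ← mul_sub, abs_mul, hσ, one_mul, abs_le]
      constructor <;> linarith
    · have hwx : w x ≤ W * δ ^ (α - 1 - 1) := by
        refine mul_le_mul_of_nonneg_left ?_ hW.le
        exact Real.rpow_le_rpow_of_nonpos hδ0 hxδ (by linarith)
      have hw0 : 0 ≤ w x := mul_nonneg hW.le (Real.rpow_nonneg hx.1.le _)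
      refine (abs_sub _ _).trans ?_
      rw [abs_mul, hσ, one_mul, abs_of_nonneg hw0]
      linarith

lemma bestPolyError_le {L : ℕ} {φ : ℝ → ℝ} {I : Set ℝ} (hI : I.Nonempty) {ε : ℝ} {P : ℝ[X]}
    (hP : P.natDegree ≤ L) (h : ∀ x ∈ I, |φ x - P.eval x| ≤ ε) : bestPolyError L φ I ≤ ε := by
  have := hI.to_subtype
  unfold bestPolyError
  refine (ciInf_le ⟨0, ?_⟩ (⟨P, hP⟩ : {g : ℝ[X] // g.natDegree ≤ L})).trans
    (ciSup_le fun x => h x x.2)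
  rintro _ ⟨g, rfl⟩
  exact Real.iSup_nonneg fun x => abs_nonneg _

lemma le_bestPolyError {L : ℕ} {φ : ℝ → ℝ} {I : Set ℝ} (hI : IsCompact I)
    (hφ : ContinuousOn φ I) {c : ℝ} (h : ∀ P : ℝ[X], P.natDegree ≤ L → ∀ ε : ℝ,
      (∀ x ∈ I, |φ x - P.eval x| ≤ ε) → c ≤ ε) : c ≤ bestPolyError L φ I := by
  have : Nonempty {g : ℝ[X] // g.natDegree ≤ L} := ⟨⟨0, by simp⟩⟩
  refine le_ciInf fun g => h g g.2 _ fun x hx => ?_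
  have hb : BddAbove ((fun x => |φ x - (g : ℝ[X]).eval x|) '' I) :=
    hI.bddAbove_image (hφ.sub (g : ℝ[X]).continuous.continuousOn).abs
  refine le_ciSup (f := fun x : I => |φ x - (g : ℝ[X]).eval (x : ℝ)|) ?_ ⟨x, hx⟩
  rwa [image_eq_range] at hb

lemma HasDivergenceSpeed.exists_bestPolyError_le {α : ℝ} (hα : α ∈ Ioo (0 : ℝ) 1) {φ : ℝ → ℝ}
    (hφ : HasDivergenceSpeed 2 α φ) :
    ∃ C : ℝ, 0 < C ∧ ∀ L : ℕ, 1 ≤ L → ∀ l ∈ Ioo (0 : ℝ) 1,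
      bestPolyError L φ (Icc 0 l) ≤ C * (l / (L : ℝ) ^ 2) ^ α := by
  obtain ⟨D, B, ψ, ψ₁, ψ₂, hD, hdec, hψ, h₁, h₂, hB⟩ := hφ.exists_decomposition hα
  obtain ⟨ha0, ha1⟩ := hα
  have hB0 : 0 ≤ B := (abs_nonneg _).trans (hB (1 / 2) (by norm_num))
  refine ⟨|D| * (Real.pi ^ 4 + 1) + B * Real.pi ^ 4, by positivity, fun L hL l hl => ?_⟩
  obtain ⟨P, hP, hPe⟩ := exists_polynomial_rpow_approximation ⟨ha0, ha1⟩ hL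
  obtain ⟨Q, hQ, hQe⟩ := exists_polynomial_approximation_of_bounded_second_deriv hψ h₁ h₂ hB hL hl
  obtain ⟨l0, l1⟩ := hl
  have hL1 : (1 : ℝ) ≤ L := by exact_mod_cast hL
  have hLsq : (1 : ℝ) ≤ (L : ℝ) ^ 2 := one_le_pow₀ hL1
  refine bestPolyError_le (P := C (D * l ^ α) * P.comp (C (1 / l) * X) + Q) ⟨0, by simp [l0.le]⟩
    ((natDegree_add_le _ _).trans (max_le ((natDegree_C_mul_le _ _).trans
      ((natDegree_comp_C_mul_X_le _ _).trans hP)) hQ)) fun x hx => ?_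
  have hy : 1 / l * x ∈ Icc (0 : ℝ) 1 := by
    rw [one_div, inv_mul_eq_div]
    exact ⟨div_nonneg hx.1 l0.le, (div_le_one l0).2 hx.2⟩
  have hxy : l ^ α * (1 / l * x) ^ α = x ^ α := by
    rw [← Real.mul_rpow l0.le hy.1]
    congr 1
    field_simp
  simp only [eval_add, eval_comp, eval_mul, eval_C, eval_X]
  rw [hdec x, ← hxy, show D * (l ^ α * (1 / l * x) ^ α) + ψ x
    - (D * l ^ α * eval (1 / l * x) P + eval x Q)
    = D * l ^ α * ((1 / l * x) ^ α - eval (1 / l * x) P) + (ψ x - eval x Q) by ring]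
  refine (abs_add_le _ _).trans ?_
  rw [abs_mul, abs_mul, abs_of_pos (Real.rpow_pos_of_pos l0 α), add_mul]
  have hsplit : (l / (L : ℝ) ^ 2) ^ α = l ^ α * (1 / (L : ℝ) ^ 2) ^ α := by
    rw [← Real.mul_rpow l0.le (by positivity), mul_one_div]
  refine add_le_add ?_ ((hQe x hx).trans ?_)
  · rw [hsplit]
    calc _ ≤ |D| * l ^ α * ((Real.pi ^ 4 + 1) * (1 / (L : ℝ) ^ 2) ^ α) := by
          gcongr
          exact hPe _ hy
      _ = _ := by ring
  · rw [mul_div_assoc]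
    refine mul_le_mul_of_nonneg_left ?_ (by positivity)
    have h1 : l ^ 2 / (L : ℝ) ^ 2 ≤ l / (L : ℝ) ^ 2 := by
      gcongr
      nlinarith
    refine h1.trans ?_
    have h2 : l / (L : ℝ) ^ 2 ≤ 1 := (div_le_one (by positivity)).2 (by linarith)
    simpa using Real.rpow_le_rpow_of_exponent_ge (by positivity) h2 ha1.le

lemma HasDivergenceSpeed.exists_le_bestPolyError {α : ℝ} (hα : α ∈ Ioo (0 : ℝ) 1) {φ : ℝ → ℝ}
    (hφ : HasDivergenceSpeed 2 α φ) :
    ∃ c : ℝ, 0 < c ∧ ∀ L : ℕ, 1 ≤ L → ∀ l ∈ Ioo (0 : ℝ) 1,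
      c * (l / (L : ℝ) ^ 2) ^ α ≤ bestPolyError L φ (Icc 0 l) := by
  obtain ⟨D, B, ψ, ψ₁, ψ₂, hD, hdec, hψ, h₁, h₂, hB⟩ := hφ.exists_decomposition hα
  obtain ⟨c, hc, hlow⟩ := exists_le_approximation_error_rpow hα
  obtain ⟨ha0, ha1⟩ := hα
  have hB0 : 0 ≤ B := (abs_nonneg _).trans (hB (1 / 2) (by norm_num))
  set K := B * Real.pi ^ 4 with hK
  have hK0 : 0 ≤ K := by positivity
  have hD0 : 0 < |D| := abs_pos.2 hD
  set r : ℝ := min (1 / 2) (|D| * c / 2 / (K + 1)) with hr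
  have hr0 : 0 < r := lt_min (by norm_num) (by positivity)
  have hr1 : r < 1 := (min_le_left _ _).trans_lt (by norm_num)
  refine ⟨|D| * c / 2 * r ^ α, by positivity, fun L hL l hl => ?_⟩
  refine le_bestPolyError isCompact_Icc (hφ.1.mono (Icc_subset_Icc_right hl.2.le))
    fun P hP ε hε => ?_
  obtain ⟨l0, l1⟩ := hl
  set m := min l r with hm
  have m0 : 0 < m := lt_min l0 hr0
  have m1 : m < 1 := (min_le_left _ _).trans_lt l1
  obtain ⟨Q, hQ, hQe⟩ :=
    exists_polynomial_approximation_of_bounded_second_deriv hψ h₁ h₂ hB hL ⟨m0, m1⟩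
  have hL1 : (1 : ℝ) ≤ L := by exact_mod_cast hL
  have hLsq : (1 : ℝ) ≤ (L : ℝ) ^ 2 := one_le_pow₀ hL1
  have hmα : 0 < m ^ α := Real.rpow_pos_of_pos m0 α
  have key := hlow L hL (C (1 / (D * m ^ α)) * (P - Q).comp (C m * X))
    ((natDegree_C_mul_le _ _).trans ((natDegree_comp_C_mul_X_le _ _).trans
      ((natDegree_sub_le _ _).trans (max_le hP hQ))))
    ((ε + K * m ^ 2 / (L : ℝ) ^ 2) / (|D| * m ^ α)) fun y hy => by
      have hmy : m * y ∈ Icc 0 m :=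
        ⟨mul_nonneg m0.le hy.1, mul_le_of_le_one_right m0.le hy.2⟩
      have b1 := hε (m * y) ⟨hmy.1, hmy.2.trans (min_le_left _ _)⟩
      have b2 := hQe (m * y) hmy
      simp only [eval_mul, eval_C, eval_comp, eval_sub, eval_X]
      rw [hdec, Real.mul_rpow m0.le hy.1] at b1
      rw [show y ^ α - 1 / (D * m ^ α) * (eval (m * y) P - eval (m * y) Q)
        = ((D * (m ^ α * y ^ α) + ψ (m * y) - eval (m * y) P) - (ψ (m * y) - eval (m * y) Q))
          / (D * m ^ α) by field_simp; ring, abs_div, abs_mul D, abs_of_pos hmα]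
      gcongr
      exact (abs_sub _ _).trans (add_le_add b1 b2)
  rw [le_div_iff₀ (by positivity)] at key
  have hsmall : K * m ^ 2 / (L : ℝ) ^ 2 ≤ |D| * c / 2 * (m ^ α * (1 / (L : ℝ) ^ 2) ^ α) := by
    have s1 : m ^ 2 ≤ m * m ^ α := by
      rw [sq]
      refine mul_le_mul_of_nonneg_left ?_ m0.le
      simpa using Real.rpow_le_rpow_of_exponent_ge m0 m1.le ha1.le
    have s2 : 1 / (L : ℝ) ^ 2 ≤ (1 / (L : ℝ) ^ 2) ^ α := by
      simpa using Real.rpow_le_rpow_of_exponent_ge (by positivity : 0 < 1 / (L : ℝ) ^ 2)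
        ((div_le_one (by positivity)).2 hLsq) ha1.le
    have s3 : K * m ≤ |D| * c / 2 := by
      have : m ≤ |D| * c / 2 / (K + 1) := (min_le_right _ _).trans (min_le_right _ _)
      rw [le_div_iff₀ (by positivity)] at this
      linarith
    calc K * m ^ 2 / (L : ℝ) ^ 2 = K * m ^ 2 * (1 / (L : ℝ) ^ 2) := by ring
      _ ≤ K * (m * m ^ α) * (1 / (L : ℝ) ^ 2) ^ α := by gcongr
      _ = K * m * (m ^ α * (1 / (L : ℝ) ^ 2) ^ α) := by ring
      _ ≤ _ := by gcongr
  have hrl : r * l ≤ m := le_min (mul_le_of_le_one_left l0.le hr1.le)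
    (mul_le_of_le_one_right hr0.le l1.le)
  have hrl' : r ^ α * (l / (L : ℝ) ^ 2) ^ α ≤ m ^ α * (1 / (L : ℝ) ^ 2) ^ α := by
    rw [← Real.mul_rpow hr0.le (by positivity), ← Real.mul_rpow m0.le (by positivity)]
    refine Real.rpow_le_rpow (by positivity) ?_ ha0.le
    rw [mul_one_div, ← mul_div_assoc]
    gcongr
  have hfin : |D| * c / 2 * (r ^ α * (l / (L : ℝ) ^ 2) ^ α)
      ≤ |D| * c / 2 * (m ^ α * (1 / (L : ℝ) ^ 2) ^ α) := by gcongr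
  linarith

theorem mainTheorem11 (α : ℝ) (hα : α ∈ Ioo (0 : ℝ) 1) (φ : ℝ → ℝ)
    (hφ : HasDivergenceSpeed 2 α φ) :
    (0 : EReal) < liminf
      (fun q : ℕ × ℝ =>
        ((((q.1 : ℝ) ^ 2 / q.2) ^ α * bestPolyError q.1 φ (Icc 0 q.2) : ℝ) : EReal))
      (atTop ×ˢ 𝓝[>] (0 : ℝ)) ∧
    ∃ c C : ℝ, 0 < c ∧ 0 < C ∧ ∀ L : ℕ, 1 ≤ L → ∀ l ∈ Ioo (0 : ℝ) 1,
      c * (l / (L : ℝ) ^ 2) ^ α ≤ bestPolyError L φ (Icc 0 l) ∧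
      bestPolyError L φ (Icc 0 l) ≤ C * (l / (L : ℝ) ^ 2) ^ α := by
  obtain ⟨c, hc, hlow⟩ := hφ.exists_le_bestPolyError hα
  obtain ⟨C, hC, hup⟩ := hφ.exists_bestPolyError_le hα
  refine ⟨?_, c, C, hc, hC, fun L hL l hl => ⟨hlow L hL l hl, hup L hL l hl⟩⟩
  refine lt_of_lt_of_le (EReal.coe_pos.2 hc) (le_liminf_of_le (by isBoundedDefault) ?_)
  filter_upwards [(eventually_ge_atTop 1).prod_mk (Ioo_mem_nhdsGT (zero_lt_one' ℝ))]
    with ⟨L, l⟩ ⟨hL, hl⟩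
  have hL0 : (0 : ℝ) < L := by exact_mod_cast hL
  have hl0 : 0 < l := hl.1
  have hq : 0 < ((L : ℝ) ^ 2 / l) ^ α := by positivity
  refine EReal.coe_le_coe_iff.2 ?_
  have h := mul_le_mul_of_nonneg_left (hlow L hL l hl) hq.le
  have hone : ((L : ℝ) ^ 2 / l) ^ α * (l / (L : ℝ) ^ 2) ^ α = 1 := by
    rw [← Real.mul_rpow (by positivity) (by positivity), div_mul_div_cancel₀ hl0.ne',
      div_self (by positivity), Real.one_rpow]
  calc c = ((L : ℝ) ^ 2 / l) ^ α * (c * (l / (L : ℝ) ^ 2) ^ α) := by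
        rw [mul_left_comm, hone, mul_one]
    _ ≤ _ := h
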